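/- Let $E$ be a real Banach space with dual $E^*$, let $S=\{S(t)\}_{t\ge 0}$ be a $C_0$-semigroup of bounded operators on $E$, and let $H$ be a real Hilbert space with a continuous linear injection $i:H\hookrightarrow E$; put $Q:=i\circ i^*\in\mathcal L(E^*,E)$. For a bounded operator $R:E^*\to E$ that is positive ($\langle Rx^*,x^*\rangle\ge 0$) and symmetric ($\langle Rx^*,y^*\rangle=\langle Ry^*,x^*\rangle$), its reproducing kernel Hilbert space $H_R$ is the completion of the range of $R$ with respect to the inner product $(Rx^*,Ry^*)\mapsto\langle Rx^*,y^*\rangle$; the inclusion of the range of $R$ into $E$ extends to a continuous injection $H_R\hookrightarrow E$, by which $H_R$ is regarded as a subset of $E$. For $t>0$ let $$Q_tx^*:=\int_0^t S(s)QS^*(s)x^*\,ds,\qquad x^*\in E^*,$$ and let $H_t$ be the reproducing kernel Hilbert space of $Q_t$. Assume hypothesis $(\mathbf{H}Q_\infty)$: for every $x^*\in E^*$ the weak limit $Q_\infty x^*:=\text{weak-}\lim_{t\to\infty}Q_tx^*$ exists in $E$. Let $H_\infty$ be the reproducing kernel Hilbert space of the positive symmetric operator $Q_\infty$; it is invariant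 under $S$, and $S_\infty(t)$ denotes the restriction of $S(t)$ to $H_\infty$, a bounded operator on $H_\infty$. Assume also that $S$ restricts to a $C_0$-semigroup $S_H$ on $H$, i.e. there is a $C_0$-semigroup $S_H$ on $H$ with $i\,S_H(t)=S(t)\,i$ for all $t\ge 0$. (A family $\{T(t)\}_{t\ge0}$ of bounded operators is called uniformly exponentially stable if there are $M\ge 0$ and $\omega>0$ with $\|T(t)\|\le Me^{-\omega t}$ for all $t\ge 0$.) Then the following assertions are equivalent: (1) $S_H$ is uniformly exponentially stable on $H$; (2) $S_\infty$ is uniformly exponentially stable on $H_\infty$; (3) for some $t>0$, $H_t=H_\infty$ as subsets of $E$, with equivalent norms; (4) for all $t>0$, $H_t=H_\infty$ as subsets of $E$, with equivalent norms; (5) $H_\infty\subseteq H$ as subsets of $E$. In this situation the inclusion $H_\infty\subseteq H$ is dense, i.e. $H_\infty$ is a dense subset of $H$ in the norm of $H$. -/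

import Mathlib

open MeasureTheory Filter Topology

noncomputable section

namespace OUGap

/-! ### Positive symmetric operators and their reproducing kernel Hilbert spaces -/

/-- A bounded positive symmetric operator `Q : E* → E`. -/
structure PosSymmOp (E : Type*) [NormedAddCommGroup E] [NormedSpace ℝ E] where
  op : StrongDual ℝ E →L[ℝ] E
  symm : ∀ x y : StrongDual ℝ E, y (op x) = x (op y)
  nonneg : ∀ x : StrongDual ℝ E, 0 ≤ x (op x)

section RKHS

variable {E : Type*} [NormedAddCommGroup E] [NormedSpace ℝ E]

theorem PosSymmOp.cauchy_schwarz (Q : PosSymmOp E) (x y : StrongDual ℝ E) :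
    (y (Q.op x)) ^ 2 ≤ x (Q.op x) * y (Q.op y) := by
  have key : ∀ t : ℝ, 0 ≤ x (Q.op x) * (t * t) + 2 * y (Q.op x) * t + y (Q.op y) := by
    intro t
    have h := Q.nonneg (t • x + y)
    have hs := Q.symm x y
    simp only [map_add, map_smul, _root_.add_apply, _root_.smul_apply,
      smul_eq_mul, ← hs] at h
    linarith
  have := discrim_le_zero key
  unfold discrim at this
  nlinarith

/-- The range of a positive symmetric operator, as a real vector space. -/
def PosSymmOp.Range (Q : PosSymmOp E) : Type _ := LinearMap.range Q.op.toLinearMap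

instance (Q : PosSymmOp E) : AddCommGroup Q.Range :=
  inferInstanceAs (AddCommGroup (LinearMap.range Q.op.toLinearMap))

instance (Q : PosSymmOp E) : Module ℝ Q.Range :=
  inferInstanceAs (Module ℝ (LinearMap.range Q.op.toLinearMap))

/-- The inclusion of the range of `Q` into `E`, as a linear map. -/
def PosSymmOp.incl (Q : PosSymmOp E) : Q.Range →ₗ[ℝ] E :=
  (LinearMap.range Q.op.toLinearMap).subtype

/-- `Q` as a map onto its range. -/
def PosSymmOp.toRange (Q : PosSymmOp E) : StrongDual ℝ E →ₗ[ℝ] Q.Range :=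
  Q.op.toLinearMap.rangeRestrict

@[simp] theorem PosSymmOp.incl_toRange (Q : PosSymmOp E) (x : StrongDual ℝ E) :
    Q.incl (Q.toRange x) = Q.op x := rfl

theorem PosSymmOp.incl_injective (Q : PosSymmOp E) : Function.Injective Q.incl :=
  Subtype.val_injective

theorem PosSymmOp.toRange_surjective (Q : PosSymmOp E) : Function.Surjective Q.toRange :=
  LinearMap.surjective_rangeRestrict _

/-- The bilinear form `(Q x, Q y) ↦ ⟨Q x, y⟩` on the range of `Q`; by symmetry of `Q` the value
does not depend on the chosen preimage, see `PosSymmOp.rangeInner_toRange`. -/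
def PosSymmOp.rangeInner (Q : PosSymmOp E) (u v : Q.Range) : ℝ :=
  (Q.toRange_surjective v).choose (Q.incl u)

theorem PosSymmOp.rangeInner_toRange (Q : PosSymmOp E) (x y : StrongDual ℝ E) :
    Q.rangeInner (Q.toRange x) (Q.toRange y) = y (Q.op x) := by
  have h := (Q.toRange_surjective (Q.toRange y)).choose_spec
  have h' := congrArg Q.incl h
  simp only [PosSymmOp.incl_toRange] at h'
  unfold PosSymmOp.rangeInner
  rw [PosSymmOp.incl_toRange, Q.symm, h', Q.symm]

/-- The inner product `[Q x, Q y] = ⟨Q x, y⟩` on the range of `Q`. -/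
@[reducible] def PosSymmOp.core (Q : PosSymmOp E) : InnerProductSpace.Core ℝ Q.Range where
  inner := Q.rangeInner
  conj_inner_symm u v := by
    obtain ⟨x, rfl⟩ := Q.toRange_surjective u
    obtain ⟨y, rfl⟩ := Q.toRange_surjective v
    simp [Q.rangeInner_toRange, Q.symm x y]
  re_inner_nonneg u := by
    obtain ⟨x, rfl⟩ := Q.toRange_surjective u
    simpa [Q.rangeInner_toRange] using Q.nonneg x
  add_left u v w := by
    obtain ⟨x, rfl⟩ := Q.toRange_surjective u
    obtain ⟨y, rfl⟩ := Q.toRange_surjective v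
    obtain ⟨z, rfl⟩ := Q.toRange_surjective w
    change Q.rangeInner _ _ = Q.rangeInner _ _ + Q.rangeInner _ _
    rw [← map_add, Q.rangeInner_toRange, Q.rangeInner_toRange, Q.rangeInner_toRange, map_add,
      map_add]
  smul_left u v r := by
    obtain ⟨x, rfl⟩ := Q.toRange_surjective u
    obtain ⟨y, rfl⟩ := Q.toRange_surjective v
    change Q.rangeInner _ _ = (starRingEnd ℝ) r * Q.rangeInner _ _
    rw [← map_smul, Q.rangeInner_toRange, Q.rangeInner_toRange, map_smul, map_smul]
    simp
  definite u hu := by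
    obtain ⟨x, rfl⟩ := Q.toRange_surjective u
    rw [Q.rangeInner_toRange] at hu
    have h0 : Q.op x = 0 := by
      refine SeparatingDual.eq_zero_of_forall_dual_eq_zero (R := ℝ) fun y => ?_
      have := Q.cauchy_schwarz x y
      rw [hu, zero_mul] at this
      exact pow_eq_zero_iff (two_ne_zero) |>.1 (le_antisymm this (sq_nonneg _))
    exact Q.incl_injective (by simpa using h0)

instance (Q : PosSymmOp E) : NormedAddCommGroup Q.Range := Q.core.toNormedAddCommGroup

instance (Q : PosSymmOp E) : InnerProductSpace ℝ Q.Range := InnerProductSpace.ofCore Q.core.toCore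

/-- The reproducing kernel Hilbert space `H_Q`: the completion of the range of `Q` in the inner
product `[Q x, Q y] = ⟨Q x, y⟩`. -/
abbrev RKHS (Q : PosSymmOp E) : Type _ := UniformSpace.Completion Q.Range

theorem PosSymmOp.inner_toRange (Q : PosSymmOp E) (x y : StrongDual ℝ E) :
    inner ℝ (Q.toRange x) (Q.toRange y) = y (Q.op x) := Q.rangeInner_toRange x y

theorem PosSymmOp.norm_toRange_sq (Q : PosSymmOp E) (x : StrongDual ℝ E) :
    ‖Q.toRange x‖ ^ 2 = x (Q.op x) := by
  rw [← Q.inner_toRange, real_inner_self_eq_norm_sq]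

theorem PosSymmOp.norm_incl_le (Q : PosSymmOp E) (u : Q.Range) :
    ‖Q.incl u‖ ≤ Real.sqrt ‖Q.op‖ * ‖u‖ := by
  obtain ⟨x, rfl⟩ := Q.toRange_surjective u
  rw [Q.incl_toRange]
  refine NormedSpace.norm_le_dual_bound ℝ _ (by positivity) fun y => ?_
  have h1 := Q.cauchy_schwarz x y
  have h2 : y (Q.op y) ≤ ‖Q.op‖ * ‖y‖ ^ 2 := by
    calc y (Q.op y) ≤ ‖y (Q.op y)‖ := Real.le_norm_self _
      _ ≤ ‖y‖ * (‖Q.op‖ * ‖y‖) :=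
        (y.le_opNorm _).trans (mul_le_mul_of_nonneg_left (Q.op.le_opNorm _) (norm_nonneg _))
      _ = _ := by ring
  rw [Real.norm_eq_abs]
  refine abs_le_of_sq_le_sq ?_ (by positivity)
  have h3 : Real.sqrt ‖Q.op‖ ^ 2 = ‖Q.op‖ := Real.sq_sqrt (norm_nonneg Q.op)
  rw [mul_pow, mul_pow, h3, Q.norm_toRange_sq]
  calc (y (Q.op x)) ^ 2 ≤ x (Q.op x) * y (Q.op y) := h1
    _ ≤ x (Q.op x) * (‖Q.op‖ * ‖y‖ ^ 2) := mul_le_mul_of_nonneg_left h2 (Q.nonneg x)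
    _ = _ := by ring

variable [CompleteSpace E]

/-- The embedding `i_Q : H_Q → E`, the continuous extension of the inclusion of the range. -/
def PosSymmOp.emb (Q : PosSymmOp E) : RKHS Q →L[ℝ] E :=
  (Q.incl.mkContinuous (Real.sqrt ‖Q.op‖) Q.norm_incl_le).extend
    (UniformSpace.Completion.toComplL : Q.Range →L[ℝ] RKHS Q)

theorem PosSymmOp.emb_coe (Q : PosSymmOp E) (u : Q.Range) : Q.emb (u : RKHS Q) = Q.incl u := by
  unfold PosSymmOp.emb
  have := (Q.incl.mkContinuous (Real.sqrt ‖Q.op‖) Q.norm_incl_le).extend_eq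
    (e := (UniformSpace.Completion.toComplL : Q.Range →L[ℝ] RKHS Q))
    UniformSpace.Completion.denseRange_coe
    (UniformSpace.Completion.isUniformInducing_coe _) u
  simpa using this

/-- `i_Q* x = Q x`, as elements of `H_Q`. -/
theorem PosSymmOp.apply_emb (Q : PosSymmOp E) (x : StrongDual ℝ E) (k : RKHS Q) :
    x (Q.emb k) = inner ℝ (Q.toRange x : RKHS Q) k := by
  induction k using UniformSpace.Completion.induction_on with
  | hp => exact isClosed_eq (by fun_prop) (by fun_prop)
  | ih u =>
    obtain ⟨y, rfl⟩ := Q.toRange_surjective u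
    rw [Q.emb_coe, Q.incl_toRange, UniformSpace.Completion.inner_coe, Q.inner_toRange, Q.symm]

theorem PosSymmOp.emb_injective (Q : PosSymmOp E) : Function.Injective Q.emb := by
  rw [injective_iff_map_eq_zero]
  intro k hk
  have h : ∀ l : RKHS Q, inner ℝ l k = 0 := by
    intro l
    induction l using UniformSpace.Completion.induction_on with
    | hp => exact isClosed_eq (by fun_prop) (by fun_prop)
    | ih u =>
      obtain ⟨y, rfl⟩ := Q.toRange_surjective u
      rw [← Q.apply_emb, hk, map_zero]
  exact inner_self_eq_zero.1 (h k)

/-- A symmetric linear map `E* → E` on the dual of a Banach space is automatically bounded. -/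
def PosSymmOp.ofLinear (Q : StrongDual ℝ E →ₗ[ℝ] E)
    (symm : ∀ x y : StrongDual ℝ E, y (Q x) = x (Q y))
    (nonneg : ∀ x : StrongDual ℝ E, 0 ≤ x (Q x)) : PosSymmOp E where
  op :=
    { Q with
      cont := by
        refine Q.continuous_of_seq_closed_graph fun u x y hu hQu => ?_
        refine (SeparatingDual.eq_iff_forall_dual_eq (R := ℝ)).2 fun z => ?_
        have h1 : Tendsto (fun n => z (Q (u n))) atTop (𝓝 (z y)) :=
          (z.continuous.tendsto y).comp hQu
        have h2 : Tendsto (fun n => u n (Q z)) atTop (𝓝 (x (Q z))) :=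
          ((ContinuousLinearMap.apply ℝ ℝ (Q z)).continuous.tendsto x).comp hu
        have h3 : (fun n => z (Q (u n))) = fun n => u n (Q z) := by
          ext n; exact symm _ _
        rw [h3] at h1
        rw [tendsto_nhds_unique h1 h2, symm x z] }
  symm := symm
  nonneg := nonneg

@[simp] theorem PosSymmOp.ofLinear_op (Q : StrongDual ℝ E →ₗ[ℝ] E) (hs) (hn)
    (x : StrongDual ℝ E) : (PosSymmOp.ofLinear Q hs hn).op x = Q x := rfl

end RKHS

/-! ### Semigroups -/

/-- A `C₀`-semigroup of bounded operators `S t`, `t ≥ 0`; values at negative times play no role. -/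
structure C0Semigroup (E : Type*) [NormedAddCommGroup E] [NormedSpace ℝ E] where
  toFun : ℝ → (E →L[ℝ] E)
  map_zero : toFun 0 = ContinuousLinearMap.id ℝ E
  map_add : ∀ s t : ℝ, 0 ≤ s → 0 ≤ t → toFun (s + t) = (toFun s).comp (toFun t)
  continuousOn : ∀ x : E, ContinuousOn (fun t => toFun t x) (Set.Ici 0)

instance (E : Type*) [NormedAddCommGroup E] [NormedSpace ℝ E] :
    CoeFun (C0Semigroup E) fun _ => ℝ → (E →L[ℝ] E) := ⟨C0Semigroup.toFun⟩

/-- Uniform exponential stability: `‖T t‖ ≤ M e^{-ω t}` for all `t ≥ 0`. -/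
def UniformlyExpStable {K : Type*} [NormedAddCommGroup K] [NormedSpace ℝ K]
    (T : ℝ → (K →L[ℝ] K)) : Prop :=
  ∃ M ω : ℝ, 0 ≤ M ∧ 0 < ω ∧ ∀ t : ℝ, 0 ≤ t → ‖T t‖ ≤ M * Real.exp (-ω * t)

/-- The family `T` on `K` is the restriction of `S` along the embedding `j : K → E`. -/
def IsRestriction {E K : Type*} [NormedAddCommGroup E] [NormedSpace ℝ E]
    [NormedAddCommGroup K] [NormedSpace ℝ K] (j : K →L[ℝ] E) (S : ℝ → (E →L[ℝ] E))
    (T : ℝ → (K →L[ℝ] K)) : Prop :=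
  ∀ t : ℝ, 0 ≤ t → ∀ k : K, j (T t k) = S t (j k)

/-- Two spaces embedded in `E` coincide as subsets of `E` and their norms are equivalent. -/
def EqualWithEquivNorms {E K₁ K₂ : Type*} [NormedAddCommGroup E] [NormedSpace ℝ E]
    [NormedAddCommGroup K₁] [NormedSpace ℝ K₁] [NormedAddCommGroup K₂] [NormedSpace ℝ K₂]
    (j₁ : K₁ →L[ℝ] E) (j₂ : K₂ →L[ℝ] E) : Prop :=
  Set.range j₁ = Set.range j₂ ∧
    ∃ c C : ℝ, 0 < c ∧ 0 < C ∧
      ∀ (h₁ : K₁) (h₂ : K₂), j₁ h₁ = j₂ h₂ → c * ‖h₂‖ ≤ ‖h₁‖ ∧ ‖h₁‖ ≤ C * ‖h₂‖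

/-! ### The operators `Q_t` and `Q_∞` -/

section Covariance

variable {E : Type*} [NormedAddCommGroup E] [NormedSpace ℝ E]
  {H : Type*} [NormedAddCommGroup H] [InnerProductSpace ℝ H] [CompleteSpace H]

/-- The adjoint `i* : E* → H` of `i : H → E`, the dual of `H` being identified with `H`. -/
def adj (i : H →L[ℝ] E) : StrongDual ℝ E →ₗ[ℝ] H where
  toFun x := (InnerProductSpace.toDual ℝ H).symm (x.comp i)
  map_add' x y := by
    rw [ContinuousLinearMap.add_comp, _root_.map_add]
  map_smul' r x := by
    rw [ContinuousLinearMap.smul_comp, LinearIsometryEquiv.map_smulₛₗ]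
    simp

theorem inner_adj (i : H →L[ℝ] E) (x : StrongDual ℝ E) (h : H) :
    inner ℝ (adj i x) h = x (i h) := by
  simp [adj]

theorem norm_adj_le (i : H →L[ℝ] E) (x : StrongDual ℝ E) : ‖adj i x‖ ≤ ‖x‖ * ‖i‖ := by
  change ‖(InnerProductSpace.toDual ℝ H).symm (x.comp i)‖ ≤ _
  rw [LinearIsometryEquiv.norm_map]
  exact x.opNorm_comp_le i

/-- The integrand `S(s) Q S*(s) x`, where `Q = i ∘ i*` and `S*(s) x = x ∘ S(s)`. -/
def integrand (i : H →L[ℝ] E) (S : C0Semigroup E) (x : StrongDual ℝ E) (s : ℝ) : E :=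
  S s (i (adj i (x.comp (S s))))

theorem apply_integrand (i : H →L[ℝ] E) (S : C0Semigroup E) (x y : StrongDual ℝ E) (s : ℝ) :
    y (integrand i S x s) = inner ℝ (adj i (y.comp (S s))) (adj i (x.comp (S s))) := by
  rw [inner_adj]; rfl

variable [CompleteSpace E]

theorem C0Semigroup.exists_bound (S : C0Semigroup E) (t : ℝ) :
    ∃ M : ℝ, 0 ≤ M ∧ ∀ s ∈ Set.Icc 0 t, ‖S s‖ ≤ M := by
  obtain ⟨M, hM⟩ := banach_steinhaus (g := fun s : Set.Icc (0 : ℝ) t => S s) (by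
    intro x
    have hc : ContinuousOn (fun s => S s x) (Set.Icc 0 t) :=
      (S.continuousOn x).mono Set.Icc_subset_Ici_self
    obtain ⟨C, hC⟩ := isCompact_Icc.exists_bound_of_continuousOn hc
    exact ⟨C, fun s => hC s s.2⟩)
  exact ⟨max M 0, le_max_right _ _, fun s hs => (hM ⟨s, hs⟩).trans (le_max_left _ _)⟩

/-- Joint strong continuity. -/
theorem C0Semigroup.continuousOn_apply (S : C0Semigroup E) {t : ℝ} {g : ℝ → E}
    (hg : ContinuousOn g (Set.Icc 0 t)) : ContinuousOn (fun s => S s (g s)) (Set.Icc 0 t) := by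
  obtain ⟨M, hM0, hM⟩ := S.exists_bound t
  intro s₀ hs₀
  have h1 : Tendsto (fun s => S s (g s₀)) (𝓝[Set.Icc 0 t] s₀) (𝓝 (S s₀ (g s₀))) :=
    ((S.continuousOn (g s₀)).mono Set.Icc_subset_Ici_self) s₀ hs₀
  have h2 : Tendsto (fun s => S s (g s - g s₀)) (𝓝[Set.Icc 0 t] s₀) (𝓝 0) := by
    have h3 : Tendsto (fun s => M * ‖g s - g s₀‖) (𝓝[Set.Icc 0 t] s₀) (𝓝 0) := by
      have := ((hg s₀ hs₀).tendsto.sub_const (g s₀)).norm.const_mul M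
      simpa using this
    refine squeeze_zero_norm' ?_ h3
    filter_upwards [self_mem_nhdsWithin] with s hs
    exact ((S s).le_opNorm _).trans (mul_le_mul_of_nonneg_right (hM s hs) (norm_nonneg _))
  have := h1.add h2
  simpa [ContinuousWithinAt] using this

theorem integrand_aestronglyMeasurable (i : H →L[ℝ] E) (S : C0Semigroup E) (x : StrongDual ℝ E)
    (t : ℝ) : AEStronglyMeasurable (integrand i S x) (volume.restrict (Set.Icc 0 t)) := by
  rcases lt_or_ge t 0 with ht | ht
  · simp [Set.Icc_eq_empty (not_le.2 ht)]
  set g : ℝ → H := fun s => adj i (x.comp (S s)) with hg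
  have hw : ∀ h : H, ContinuousOn (fun s => inner ℝ h (g s)) (Set.Icc 0 t) := by
    intro h
    have h0 : ContinuousOn (fun s => x (S s (i h))) (Set.Icc 0 t) :=
      x.continuous.comp_continuousOn ((S.continuousOn (i h)).mono Set.Icc_subset_Ici_self)
    refine h0.congr fun s _ => ?_
    simp only [hg]
    rw [real_inner_comm, inner_adj]; rfl
  have : Nonempty (Set.Icc (0 : ℝ) t) := ⟨⟨0, le_rfl, ht⟩⟩
  let q : ℕ → Set.Icc (0 : ℝ) t := TopologicalSpace.denseSeq _
  have hq : DenseRange q := TopologicalSpace.denseRange_denseSeq _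
  classical
  let U : ℕ → Submodule ℝ H := fun n =>
    Submodule.span ℝ ((Finset.range n).image fun k => g (q k) : Finset H)
  have : ∀ n, FiniteDimensional ℝ (U n) := fun n => FiniteDimensional.span_finset ℝ _
  have hU : Monotone U := by
    intro m n hmn
    refine Submodule.span_mono ?_
    exact_mod_cast Finset.image_subset_image (Finset.range_mono hmn)
  have hmem : ∀ s ∈ Set.Icc 0 t, g s ∈ (⨆ n, U n).topologicalClosure := by
    intro s hs
    rw [← Submodule.orthogonal_orthogonal_eq_closure, Submodule.mem_orthogonal]
    intro v hv
    have hv' : ∀ k, inner ℝ v (g (q k)) = 0 := by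
      intro k
      rw [real_inner_comm]
      refine (Submodule.mem_orthogonal _ _).1 hv _ ?_
      refine (le_iSup U (k + 1)) (Submodule.subset_span ?_)
      simp only [Finset.coe_image, Set.mem_image, Finset.coe_range, Set.mem_Iio]
      exact ⟨k, Nat.lt_succ_self k, rfl⟩
    have hc : Continuous fun s : Set.Icc (0 : ℝ) t => inner ℝ v (g s) :=
      continuousOn_iff_continuous_domRestrict.1 (hw v)
    have := hq.equalizer hc (continuous_const (y := (0 : ℝ))) (by ext k; exact hv' k)
    exact congrFun this ⟨s, hs⟩
  let F : ℕ → ℝ → E := fun n s => S s (i ((U n).starProjection (g s)))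
  have hFc : ∀ n, ContinuousOn (F n) (Set.Icc 0 t) := by
    intro n
    refine S.continuousOn_apply (i.continuous.comp_continuousOn ?_)
    let b := stdOrthonormalBasis ℝ (U n)
    have : (fun s => (U n).starProjection (g s)) =
        fun s => ∑ k, (inner ℝ (b k : H) (g s)) • (b k : H) := by
      ext s
      simp [b.starProjection_eq_sum_rankOne]
    rw [this]
    exact continuousOn_finsetSum _ fun k _ => (hw _).smul continuousOn_const
  have hlim : ∀ s ∈ Set.Icc 0 t, Tendsto (fun n => F n s) atTop (𝓝 (integrand i S x s)) := by
    intro s hs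
    have h1 := Submodule.starProjection_tendsto_closure_iSup U hU (g s)
    rw [Submodule.starProjection_eq_self_iff.2 (hmem s hs)] at h1
    exact ((S s).continuous.tendsto _).comp ((i.continuous.tendsto _).comp h1)
  refine aestronglyMeasurable_of_tendsto_ae atTop
    (fun n => (hFc n).aestronglyMeasurable measurableSet_Icc) ?_
  exact (ae_restrict_iff' measurableSet_Icc).2 (Eventually.of_forall hlim)

theorem integrand_integrableOn (i : H →L[ℝ] E) (S : C0Semigroup E) (x : StrongDual ℝ E)
    (t : ℝ) : IntegrableOn (integrand i S x) (Set.Icc 0 t) := by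
  obtain ⟨M, hM0, hM⟩ := S.exists_bound t
  refine ⟨integrand_aestronglyMeasurable i S x t, HasFiniteIntegral.restrict_of_bounded
    (M * (‖i‖ * (‖x‖ * M * ‖i‖))) measure_Icc_lt_top ?_⟩
  refine (ae_restrict_iff' measurableSet_Icc).2 (Eventually.of_forall fun s hs => ?_)
  have h1 : ‖adj i (x.comp (S s))‖ ≤ ‖x‖ * M * ‖i‖ :=
    (norm_adj_le i _).trans (mul_le_mul_of_nonneg_right
      ((x.opNorm_comp_le _).trans (mul_le_mul_of_nonneg_left (hM s hs) (norm_nonneg _)))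
      (norm_nonneg _))
  calc ‖integrand i S x s‖ ≤ ‖S s‖ * ‖i (adj i (x.comp (S s)))‖ := (S s).le_opNorm _
    _ ≤ M * (‖i‖ * (‖x‖ * M * ‖i‖)) := by
      refine mul_le_mul (hM s hs) ((i.le_opNorm _).trans ?_) (norm_nonneg _) hM0
      exact mul_le_mul_of_nonneg_left h1 (norm_nonneg _)

theorem apply_integral_integrand (i : H →L[ℝ] E) (S : C0Semigroup E) (x y : StrongDual ℝ E)
    (t : ℝ) : y (∫ s in Set.Icc 0 t, integrand i S x s) =
      ∫ s in Set.Icc 0 t, inner ℝ (adj i (y.comp (S s))) (adj i (x.comp (S s))) := by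
  rw [← y.integral_comp_comm (integrand_integrableOn i S x t)]
  simp only [apply_integrand]

/-- `Q_t x = ∫₀ᵗ S(s) Q S*(s) x ds` (a Bochner integral in `E`). -/
def covOp (i : H →L[ℝ] E) (S : C0Semigroup E) (t : ℝ) : PosSymmOp E :=
  PosSymmOp.ofLinear
    { toFun := fun x => ∫ s in Set.Icc 0 t, integrand i S x s
      map_add' := fun x y => by
        rw [← integral_add (integrand_integrableOn i S x t) (integrand_integrableOn i S y t)]
        simp [integrand, ContinuousLinearMap.add_comp]
      map_smul' := fun r x => by
        rw [RingHom.id_apply, ← integral_smul]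
        simp [integrand, ContinuousLinearMap.smul_comp] }
    (fun x y => by
      change y (∫ s in Set.Icc 0 t, integrand i S x s) = x (∫ s in Set.Icc 0 t, integrand i S y s)
      rw [apply_integral_integrand, apply_integral_integrand]
      simp only [real_inner_comm])
    (fun x => by
      change 0 ≤ x (∫ s in Set.Icc 0 t, integrand i S x s)
      rw [apply_integral_integrand]
      exact integral_nonneg fun s => real_inner_self_nonneg)

theorem covOp_apply (i : H →L[ℝ] E) (S : C0Semigroup E) (t : ℝ) (x : StrongDual ℝ E) :
    (covOp i S t).op x = ∫ s in Set.Icc 0 t, integrand i S x s := rfl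

/-- Hypothesis `(HQ_∞)`: for every `x ∈ E*` the weak limit of `Q_t x` as `t → ∞` exists in `E`. -/
def HypQInfty (i : H →L[ℝ] E) (S : C0Semigroup E) : Prop :=
  ∀ x : StrongDual ℝ E, ∃ e : E, ∀ y : StrongDual ℝ E,
    Tendsto (fun t : ℝ => y ((covOp i S t).op x)) atTop (𝓝 (y e))

variable {i : H →L[ℝ] E} {S : C0Semigroup E}

/-- `Q_∞ x`, the weak limit of `Q_t x` as `t → ∞`. -/
def HypQInfty.lim (hQ : HypQInfty i S) (x : StrongDual ℝ E) : E := (hQ x).choose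

theorem HypQInfty.tendsto (hQ : HypQInfty i S) (x y : StrongDual ℝ E) :
    Tendsto (fun t : ℝ => y ((covOp i S t).op x)) atTop (𝓝 (y (hQ.lim x))) :=
  (hQ x).choose_spec y

/-- The positive symmetric operator `Q_∞`. -/
def covOpInfty (hQ : HypQInfty i S) : PosSymmOp E :=
  PosSymmOp.ofLinear
    { toFun := hQ.lim
      map_add' := fun x x' => (SeparatingDual.eq_iff_forall_dual_eq (R := ℝ)).2 fun y => by
        refine tendsto_nhds_unique (hQ.tendsto (x + x') y) ?_
        simpa using (hQ.tendsto x y).add (hQ.tendsto x' y)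
      map_smul' := fun r x => (SeparatingDual.eq_iff_forall_dual_eq (R := ℝ)).2 fun y => by
        refine tendsto_nhds_unique (hQ.tendsto (r • x) y) ?_
        simpa using (hQ.tendsto x y).const_mul r }
    (fun x y => tendsto_nhds_unique (hQ.tendsto x y) (by
      have h := hQ.tendsto y x
      simp only [(covOp i S _).symm y x] at h
      exact h))
    (fun x => ge_of_tendsto' (hQ.tendsto x x) fun t => (covOp i S t).nonneg x)

theorem covOpInfty_tendsto (hQ : HypQInfty i S) (x y : StrongDual ℝ E) :
    Tendsto (fun t : ℝ => y ((covOp i S t).op x)) atTop (𝓝 (y ((covOpInfty hQ).op x))) :=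
  hQ.tendsto x y

/-! ### The restricted semigroup `S_∞` on `H_∞` -/

theorem covOpInfty_comp_le (hQ : HypQInfty i S) {t : ℝ} (ht : 0 ≤ t) (x : StrongDual ℝ E) :
    (x.comp (S t)) ((covOpInfty hQ).op (x.comp (S t))) ≤ x ((covOpInfty hQ).op x) := by
  let φ : ℝ → ℝ := fun s => inner ℝ (adj i (x.comp (S s))) (adj i (x.comp (S s)))
  have hφ : ∀ r, IntegrableOn φ (Set.Icc 0 r) := fun r => by
    have := x.integrable_comp (integrand_integrableOn i S x r)
    simp only [apply_integrand] at this
    exact this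
  have key : ∀ r : ℝ, 0 ≤ r → (x.comp (S t)) ((covOp i S r).op (x.comp (S t))) ≤
      x ((covOp i S (r + t)).op x) := by
    intro r hr
    rw [covOp_apply, apply_integral_integrand, covOp_apply, apply_integral_integrand]
    calc ∫ s in Set.Icc 0 r, inner ℝ (adj i ((x.comp (S t)).comp (S s)))
          (adj i ((x.comp (S t)).comp (S s)))
        = ∫ s in Set.Icc 0 r, φ (s + t) := by
          refine setIntegral_congr_fun measurableSet_Icc fun s hs => ?_
          simp only [φ]
          rw [add_comm s t, S.map_add t s ht hs.1, ContinuousLinearMap.comp_assoc]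
      _ = ∫ s in Set.Icc (0 + t) (r + t), φ s := by
          rw [integral_Icc_eq_integral_Ioc, integral_Icc_eq_integral_Ioc,
            ← intervalIntegral.integral_of_le hr, ← intervalIntegral.integral_of_le (by linarith),
            intervalIntegral.integral_comp_add_right]
      _ ≤ ∫ s in Set.Icc 0 (r + t), φ s := by
          refine setIntegral_mono_set (hφ _) (Eventually.of_forall fun s => ?_)
            (LE.le.eventuallyLE (Set.Icc_subset_Icc_left (by linarith)))
          exact real_inner_self_nonneg
  refine le_of_tendsto_of_tendsto (covOpInfty_tendsto hQ (x.comp (S t)) (x.comp (S t)))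
    ((covOpInfty_tendsto hQ x x).comp (tendsto_atTop_add_const_right atTop t tendsto_id)) ?_
  filter_upwards [eventually_ge_atTop 0] with r hr using key r hr

/-- `H_∞` is invariant under `S`, and each `S t` restricts to a unique bounded operator on it. -/
theorem existsUnique_restrict (hQ : HypQInfty i S) {t : ℝ} (ht : 0 ≤ t) :
    ∃! T : RKHS (covOpInfty hQ) →L[ℝ] RKHS (covOpInfty hQ),
      ∀ h, (covOpInfty hQ).emb (T h) = S t ((covOpInfty hQ).emb h) := by
  set Q := covOpInfty hQ with hQdef
  let e : StrongDual ℝ E →ₗ[ℝ] RKHS Q :=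
    (UniformSpace.Completion.toComplL : Q.Range →L[ℝ] RKHS Q).toLinearMap ∘ₗ Q.toRange
  let p : StrongDual ℝ E →ₗ[ℝ] StrongDual ℝ E :=
    { toFun := fun x => x.comp (S t)
      map_add' := fun x y => ContinuousLinearMap.add_comp _ _ _
      map_smul' := fun r x => ContinuousLinearMap.smul_comp _ _ _ }
  have he : DenseRange e :=
    UniformSpace.Completion.denseRange_coe.comp Q.toRange_surjective.denseRange
      (UniformSpace.Completion.continuous_coe _)
  have hn : ∀ x, ‖(e ∘ₗ p) x‖ ≤ 1 * ‖e x‖ := by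
    intro x
    rw [one_mul]
    change ‖(Q.toRange (x.comp (S t)) : RKHS Q)‖ ≤ ‖(Q.toRange x : RKHS Q)‖
    rw [UniformSpace.Completion.norm_coe, UniformSpace.Completion.norm_coe]
    refine le_of_sq_le_sq ?_ (norm_nonneg _)
    rw [Q.norm_toRange_sq, Q.norm_toRange_sq]
    exact covOpInfty_comp_le hQ ht x
  let R : RKHS Q →L[ℝ] RKHS Q := (e ∘ₗ p).extendOfNorm e
  have hR : ∀ x, R (e x) = e (p x) := fun x => LinearMap.extendOfNorm_eq he ⟨1, hn⟩ x
  refine ⟨ContinuousLinearMap.adjoint R, fun h => ?_, fun T hT => ?_⟩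
  · refine (SeparatingDual.eq_iff_forall_dual_eq (R := ℝ)).2 fun y => ?_
    rw [Q.apply_emb, ContinuousLinearMap.adjoint_inner_right]
    have h1 : R (Q.toRange y : RKHS Q) = (Q.toRange (y.comp (S t)) : RKHS Q) := hR y
    rw [h1, ← Q.apply_emb]
    rfl
  · ext h
    refine Q.emb_injective ((hT h).trans ?_)
    refine (SeparatingDual.eq_iff_forall_dual_eq (R := ℝ)).2 fun y => ?_
    rw [Q.apply_emb, ContinuousLinearMap.adjoint_inner_right]
    have h1 : R (Q.toRange y : RKHS Q) = (Q.toRange (y.comp (S t)) : RKHS Q) := hR y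
    rw [h1, ← Q.apply_emb]
    rfl

/-- `S_∞(t)`, the restriction of `S(t)` to `H_∞`, for `t ≥ 0`. -/
def semigroupInfty (hQ : HypQInfty i S) (t : ℝ) :
    RKHS (covOpInfty hQ) →L[ℝ] RKHS (covOpInfty hQ) :=
  if ht : 0 ≤ t then (existsUnique_restrict hQ ht).choose else 0

theorem semigroupInfty_isRestriction (hQ : HypQInfty i S) :
    IsRestriction (covOpInfty hQ).emb S (semigroupInfty hQ) := by
  intro t ht k
  rw [semigroupInfty, dif_pos ht]
  exact (existsUnique_restrict hQ ht).choose_spec.1 k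

end Covariance

end OUGap

end

/-! A Hilbert space embedded by `j` in `E` is seen through the form `x ↦ ‖j* x‖²` on `E*`; for the
reproducing kernel space of `R` this is `⟨R x, x⟩`. By a Douglas-type argument, inclusion of ranges
amounts to majorization of these forms up to a constant, so every assertion becomes an inequality
between forms.

Write `V_t(x) = ⟨Q_t x, x⟩ = ∫₀ᵗ ‖i* S*(s) x‖² ds` and let `V_∞` be its limit. Shifting the integral
gives `V_∞(x) = V_t(x) + V_∞(S*(t) x)`, and `‖S_∞(t)‖²` is the best constant in `V_∞(S*(t) x) ≤ c
V_∞(x)`.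

(1 → 2) Since `i* S*(t) = S_H(t)* i*`, `V_r(S*(t) x) ≤ ‖S_H(t)‖² V_r(x)`; let `r → ∞`. (2 → 3) If
`‖S_∞(t)‖ ≤ 1/2`, the identity absorbs the last term and `V_∞ ≤ 2 V_t`. (3 → 4) The shift also gives
`V_{nt} ≤ C V_t`, so a large time can be traded for any positive one. (4 → 5) `V_1(x) ≤ M² ‖i* x‖²`,
with `M` a bound for `S_H` on `[0, 1]`. (5 → 1) Now `V_∞(x) ≤ C ‖i* x‖²`: adjoint orbits of `S_H`
are uniformly square integrable, and Datko's argument (`mul_norm_adj_comp_sq_le`) applies.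

Density: by `inner_integral_le`, a vector `g` orthogonal to `H_∞` satisfies `⟨g, ∫₀ʳ S_H(s) g ds⟩ ≤
0` for all `r ≥ 0`; dividing by `r` and letting `r → 0` yields `g = 0`. -/

namespace OUGap

/-! ### Embedded Hilbert spaces compared through the adjoints of their embeddings -/

section Factorization

variable {E : Type*} [NormedAddCommGroup E] [NormedSpace ℝ E]
  {K₁ : Type*} [NormedAddCommGroup K₁] [InnerProductSpace ℝ K₁] [CompleteSpace K₁]
  {K₂ : Type*} [NormedAddCommGroup K₂] [InnerProductSpace ℝ K₂] [CompleteSpace K₂]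

/-- A vector orthogonal to the range of `j*` is sent by `j` to a point killed by every functional,
so it lies in the kernel of `j`. -/
theorem denseRange_adj {j : K₁ →L[ℝ] E} (hj : Function.Injective j) : DenseRange (adj j) := by
  have h : (LinearMap.range (adj j)).topologicalClosure = ⊤ := by
    rw [Submodule.topologicalClosure_eq_top_iff, Submodule.eq_bot_iff]
    intro k hk
    refine hj ?_
    rw [map_zero]
    refine SeparatingDual.eq_zero_of_forall_dual_eq_zero (R := ℝ) fun x => ?_
    rw [← inner_adj]
    exact (Submodule.mem_orthogonal _ _).1 hk _ ⟨x, rfl⟩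
  have := (Submodule.dense_iff_topologicalClosure_eq_top).2 h
  exact this

/-- If `j₂ ∘ T = A ∘ j₁`, then `j₁* A* x = T* j₂* x`. -/
theorem adj_comp_eq_adjoint {F : Type*} [NormedAddCommGroup F] [NormedSpace ℝ F]
    {j₁ : K₁ →L[ℝ] E} {j₂ : K₂ →L[ℝ] F} {A : E →L[ℝ] F} {T : K₁ →L[ℝ] K₂}
    (h : ∀ k, j₂ (T k) = A (j₁ k)) (x : StrongDual ℝ F) :
    adj j₁ (x.comp A) = ContinuousLinearMap.adjoint T (adj j₂ x) := by
  refine ext_inner_right ℝ fun k => ?_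
  rw [inner_adj, ContinuousLinearMap.adjoint_inner_left, inner_adj, h]
  rfl

/-- A contractivity estimate for the adjoints on a dense set bounds the norm of an operator. -/
theorem norm_le_of_norm_adj_comp_le {j : K₁ →L[ℝ] E} (hj : Function.Injective j) {A : E →L[ℝ] E}
    {T : K₁ →L[ℝ] K₁} (h : ∀ k, j (T k) = A (j k)) {c : ℝ} (hc : 0 ≤ c)
    (hb : ∀ x : StrongDual ℝ E, ‖adj j (x.comp A)‖ ≤ c * ‖adj j x‖) : ‖T‖ ≤ c := by
  rw [← LinearIsometryEquiv.norm_map ContinuousLinearMap.adjoint T]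
  refine ContinuousLinearMap.opNorm_le_bound _ hc fun k => ?_
  refine (denseRange_adj hj).induction_on
    (p := fun k => ‖ContinuousLinearMap.adjoint T k‖ ≤ c * ‖k‖) k
    (isClosed_le (by fun_prop) (by fun_prop)) fun x => ?_
  rw [← adj_comp_eq_adjoint h]
  exact hb x

theorem norm_adj_comp_le {j : K₁ →L[ℝ] E} {A : E →L[ℝ] E}
    {T : K₁ →L[ℝ] K₁} (h : ∀ k, j (T k) = A (j k)) (x : StrongDual ℝ E) :
    ‖adj j (x.comp A)‖ ≤ ‖T‖ * ‖adj j x‖ := by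
  rw [adj_comp_eq_adjoint h, ← LinearIsometryEquiv.norm_map ContinuousLinearMap.adjoint T]
  exact ContinuousLinearMap.le_opNorm _ _

/-- An inclusion of ranges is implemented by a bounded operator. -/
theorem exists_factor_of_range_subset {j₁ : K₁ →L[ℝ] E} {j₂ : K₂ →L[ℝ] E}
    (hj₂ : Function.Injective j₂) (h : Set.range j₁ ⊆ Set.range j₂) :
    ∃ T : K₁ →L[ℝ] K₂, ∀ k, j₂ (T k) = j₁ k := by
  choose f hf using fun k => h ⟨k, rfl⟩
  let T : K₁ →ₗ[ℝ] K₂ :=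
    { toFun := f
      map_add' := fun a b => hj₂ (by simp only [map_add, hf])
      map_smul' := fun r a => hj₂ (by simp only [map_smul, hf, RingHom.id_apply]) }
  -- Closed graph theorem: both candidate limits agree after applying `j₂`, which is injective.
  refine ⟨⟨T, T.continuous_of_seq_closed_graph fun u x y hu hTu => hj₂ ?_⟩, hf⟩
  have h1 : Tendsto (fun n => j₂ (T (u n))) atTop (𝓝 (j₂ y)) := (j₂.continuous.tendsto y).comp hTu
  have h2 : Tendsto (fun n => j₁ (u n)) atTop (𝓝 (j₁ x)) := (j₁.continuous.tendsto x).comp hu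
  have h3 : (fun n => j₂ (T (u n))) = fun n => j₁ (u n) := funext fun n => hf _
  rw [h3] at h1
  exact (tendsto_nhds_unique h1 h2).trans (hf x).symm

theorem norm_adj_le_of_factor {j₁ : K₁ →L[ℝ] E} {j₂ : K₂ →L[ℝ] E} {T : K₁ →L[ℝ] K₂}
    (h : ∀ k, j₂ (T k) = j₁ k) (x : StrongDual ℝ E) : ‖adj j₁ x‖ ≤ ‖T‖ * ‖adj j₂ x‖ := by
  have := adj_comp_eq_adjoint (A := ContinuousLinearMap.id ℝ E) h x
  rw [ContinuousLinearMap.comp_id] at this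
  rw [this, ← LinearIsometryEquiv.norm_map ContinuousLinearMap.adjoint T]
  exact ContinuousLinearMap.le_opNorm _ _

/-- Majorization of the adjoints yields a bounded factorization. -/
theorem exists_factor_of_norm_adj_le {j₁ : K₁ →L[ℝ] E} {j₂ : K₂ →L[ℝ] E}
    (hj₂ : Function.Injective j₂) {C : ℝ}
    (h : ∀ x : StrongDual ℝ E, ‖adj j₁ x‖ ≤ C * ‖adj j₂ x‖) :
    ∃ T : K₁ →L[ℝ] K₂, ∀ k, j₂ (T k) = j₁ k := by
  -- The bound makes `j₂* x ↦ j₁* x` well defined and bounded on a dense subspace; the adjoint of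
  -- its extension is the factor.
  let R : K₂ →L[ℝ] K₁ := (adj j₁).extendOfNorm (adj j₂)
  have hR : ∀ x, R (adj j₂ x) = adj j₁ x := fun x =>
    LinearMap.extendOfNorm_eq (denseRange_adj hj₂) ⟨C, h⟩ x
  refine ⟨ContinuousLinearMap.adjoint R, fun k => ?_⟩
  refine (SeparatingDual.eq_iff_forall_dual_eq (R := ℝ)).2 fun y => ?_
  rw [← inner_adj, ContinuousLinearMap.adjoint_inner_right, hR, inner_adj]

theorem equalWithEquivNorms_of_norm_adj_le {j₁ : K₁ →L[ℝ] E} {j₂ : K₂ →L[ℝ] E}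
    (hj₁ : Function.Injective j₁) (hj₂ : Function.Injective j₂) {C₁ C₂ : ℝ}
    (h₁ : ∀ x : StrongDual ℝ E, ‖adj j₁ x‖ ≤ C₁ * ‖adj j₂ x‖)
    (h₂ : ∀ x : StrongDual ℝ E, ‖adj j₂ x‖ ≤ C₂ * ‖adj j₁ x‖) :
    EqualWithEquivNorms j₁ j₂ := by
  obtain ⟨T₁, hT₁⟩ := exists_factor_of_norm_adj_le hj₂ h₁
  obtain ⟨T₂, hT₂⟩ := exists_factor_of_norm_adj_le hj₁ h₂
  -- Adding 1 keeps both constants positive even when a factor is zero.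
  refine ⟨Set.Subset.antisymm ?_ ?_, (‖T₁‖ + 1)⁻¹, ‖T₂‖ + 1, by positivity, by positivity,
    fun k₁ k₂ hk => ⟨?_, ?_⟩⟩
  · rintro _ ⟨k, rfl⟩
    exact ⟨T₁ k, hT₁ k⟩
  · rintro _ ⟨k, rfl⟩
    exact ⟨T₂ k, hT₂ k⟩
  · rw [inv_mul_le_iff₀ (by positivity), ← hj₂ ((hT₁ k₁).trans hk)]
    exact (T₁.le_opNorm _).trans (by gcongr; linarith)
  · rw [← hj₁ ((hT₂ k₂).trans hk.symm)]
    exact (T₂.le_opNorm _).trans (by gcongr; linarith)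

/-- The bridge from embeddings to forms: `i_Q* x` is the class of `Q x` in `H_Q`. -/
theorem PosSymmOp.norm_adj_emb_sq [CompleteSpace E] (Q : PosSymmOp E) (x : StrongDual ℝ E) :
    ‖adj Q.emb x‖ ^ 2 = x (Q.op x) := by
  have h : adj Q.emb x = (Q.toRange x : RKHS Q) := by
    refine ext_inner_right ℝ fun k => ?_
    rw [inner_adj, Q.apply_emb]
  rw [h, UniformSpace.Completion.norm_coe, Q.norm_toRange_sq]

end Factorization

/-! ### Semigroup law on functionals and exponential decay -/

theorem C0Semigroup.comp_comp {E : Type*} [NormedAddCommGroup E] [NormedSpace ℝ E]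
    (S : C0Semigroup E) (x : StrongDual ℝ E) {s t : ℝ} (hs : 0 ≤ s)
    (ht : 0 ≤ t) : (x.comp (S t)).comp (S s) = x.comp (S (t + s)) := by
  rw [S.map_add t s ht hs, ContinuousLinearMap.comp_assoc]

/-- A locally bounded semigroup with some `‖T t‖ < 1` is uniformly exponentially stable. -/
theorem uniformlyExpStable_of_norm_lt_one {K : Type*} [NormedAddCommGroup K] [NormedSpace ℝ K]
    {T : ℝ → (K →L[ℝ] K)} (hT : ∀ s t : ℝ, 0 ≤ s → 0 ≤ t → T (s + t) = (T s).comp (T t))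
    {t₀ M : ℝ} (ht₀ : 0 < t₀) (hM : ∀ s ∈ Set.Icc 0 t₀, ‖T s‖ ≤ M) (h : ‖T t₀‖ < 1) :
    UniformlyExpStable T := by
  have hM0 : 0 ≤ M := (norm_nonneg _).trans (hM 0 ⟨le_rfl, ht₀.le⟩)
  -- The maximum with 1/2 keeps `q` positive, so that `log q` is meaningful even if `T t₀ = 0`.
  obtain ⟨q, hq0, hq1, hq⟩ : ∃ q : ℝ, 0 < q ∧ q < 1 ∧ ‖T t₀‖ ≤ q :=
    ⟨max ‖T t₀‖ (1 / 2), by positivity, max_lt h (by norm_num), le_max_left _ _⟩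
  have hn : ∀ (n : ℕ) (s : ℝ), s ∈ Set.Icc 0 t₀ → ‖T (n * t₀ + s)‖ ≤ q ^ n * M := by
    intro n s hs
    induction n with
    | zero => simpa using hM s hs
    | succ n ih =>
      have e : ((n + 1 : ℕ) : ℝ) * t₀ + s = t₀ + (n * t₀ + s) := by push_cast; ring
      rw [e, hT _ _ ht₀.le (by have := hs.1; positivity), pow_succ']
      calc ‖(T t₀).comp (T (n * t₀ + s))‖ ≤ ‖T t₀‖ * ‖T (n * t₀ + s)‖ :=
            ContinuousLinearMap.opNorm_comp_le _ _
        _ ≤ q * (q ^ n * M) := by gcongr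
        _ = _ := by ring
  have hlog : Real.log q < 0 := Real.log_neg hq0 hq1
  refine ⟨M * q⁻¹, -Real.log q / t₀, by positivity, div_pos (neg_pos.2 hlog) ht₀, fun t ht => ?_⟩
  set n := ⌊t / t₀⌋₊
  have h1 : (n : ℝ) ≤ t / t₀ := Nat.floor_le (by positivity)
  have h2 : t / t₀ < n + 1 := Nat.lt_floor_add_one _
  rw [le_div_iff₀ ht₀] at h1
  have h3 := hn n (t - n * t₀) ⟨by linarith, by rw [div_lt_iff₀ ht₀] at h2; linarith⟩
  rw [add_sub_cancel] at h3
  -- As `n > t / t₀ - 1` and `log q < 0`, rounding down costs one factor `q⁻¹`.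
  have h4 : q ^ n ≤ q⁻¹ * Real.exp (-(-Real.log q / t₀) * t) := by
    rw [← Real.exp_log (pow_pos hq0 n), ← Real.exp_log (inv_pos.2 hq0), ← Real.exp_add,
      Real.exp_le_exp, Real.log_pow, Real.log_inv]
    have e : -(-Real.log q / t₀) * t = Real.log q * (t / t₀) := by ring
    rw [e]
    nlinarith
  calc ‖T t‖ ≤ q ^ n * M := h3
    _ ≤ (q⁻¹ * Real.exp (-(-Real.log q / t₀) * t)) * M := by gcongr
    _ = _ := by ring

/-! ### The quadratic forms of `Q_t` and `Q_∞` -/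

section Covariance

variable {E : Type*} [NormedAddCommGroup E] [NormedSpace ℝ E] [CompleteSpace E]
  {H : Type*} [NormedAddCommGroup H] [InnerProductSpace ℝ H] [CompleteSpace H]

theorem intervalIntegrable_norm_adj_sq (i : H →L[ℝ] E) (S : C0Semigroup E) (x : StrongDual ℝ E)
    {a b : ℝ} (ha : 0 ≤ a) (hb : 0 ≤ b) :
    IntervalIntegrable (fun s => ‖adj i (x.comp (S s))‖ ^ 2) volume a b := by
  have h : IntegrableOn (fun s => ‖adj i (x.comp (S s))‖ ^ 2) (Set.Icc 0 (max a b)) := by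
    have := x.integrable_comp (integrand_integrableOn i S x (max a b))
    simp only [apply_integrand, real_inner_self_eq_norm_sq] at this
    exact this
  rw [intervalIntegrable_iff]
  refine h.mono_set fun s hs => ⟨?_, hs.2⟩
  exact (le_min ha hb).trans hs.1.le

theorem covOp_quadratic (i : H →L[ℝ] E) (S : C0Semigroup E) (x : StrongDual ℝ E) {t : ℝ}
    (ht : 0 ≤ t) :
    x ((covOp i S t).op x) = ∫ s in (0 : ℝ)..t, ‖adj i (x.comp (S s))‖ ^ 2 := by
  rw [covOp_apply, apply_integral_integrand, integral_Icc_eq_integral_Ioc,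
    ← intervalIntegral.integral_of_le ht]
  simp only [real_inner_self_eq_norm_sq]

/-- The integral is split at `t` and its tail shifted back to start at 0. -/
theorem covOp_quadratic_add (i : H →L[ℝ] E) (S : C0Semigroup E) (x : StrongDual ℝ E) {t r : ℝ}
    (ht : 0 ≤ t) (hr : 0 ≤ r) :
    x ((covOp i S (t + r)).op x) =
      x ((covOp i S t).op x) + (x.comp (S t)) ((covOp i S r).op (x.comp (S t))) := by
  have htr : 0 ≤ t + r := add_nonneg ht hr
  have h : ∫ s in (0 : ℝ)..r, ‖adj i ((x.comp (S t)).comp (S s))‖ ^ 2 =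
      ∫ s in t..(t + r), ‖adj i (x.comp (S s))‖ ^ 2 := by
    have h1 := intervalIntegral.integral_comp_add_left (a := 0) (b := r)
      (fun s => ‖adj i (x.comp (S s))‖ ^ 2) t
    rw [add_zero] at h1
    rw [← h1]
    refine intervalIntegral.integral_congr fun s hs => ?_
    rw [Set.uIcc_of_le hr] at hs
    simp only [S.comp_comp x hs.1 ht]
  rw [covOp_quadratic i S x htr, covOp_quadratic i S x ht, covOp_quadratic i S _ hr, h,
    intervalIntegral.integral_add_adjacent_intervals
      (intervalIntegrable_norm_adj_sq i S x le_rfl ht)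
      (intervalIntegrable_norm_adj_sq i S x ht htr)]

variable {i : H →L[ℝ] E} {S : C0Semigroup E}

theorem covOpInfty_quadratic_eq_add (hQ : HypQInfty i S) (x : StrongDual ℝ E) {t : ℝ}
    (ht : 0 ≤ t) :
    x ((covOpInfty hQ).op x) =
      x ((covOp i S t).op x) + (x.comp (S t)) ((covOpInfty hQ).op (x.comp (S t))) := by
  refine tendsto_nhds_unique
    ((covOpInfty_tendsto hQ x x).comp (tendsto_atTop_add_const_left atTop t tendsto_id)) ?_
  refine ((covOpInfty_tendsto hQ (x.comp (S t)) (x.comp (S t))).const_add _).congr' ?_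
  filter_upwards [eventually_ge_atTop 0] with r hr
  exact (covOp_quadratic_add i S x ht hr).symm

theorem covOp_quadratic_le_covOpInfty (hQ : HypQInfty i S) (x : StrongDual ℝ E) {t : ℝ}
    (ht : 0 ≤ t) : x ((covOp i S t).op x) ≤ x ((covOpInfty hQ).op x) := by
  rw [covOpInfty_quadratic_eq_add hQ x ht]
  exact le_add_of_nonneg_right ((covOpInfty hQ).nonneg _)

theorem covOp_quadratic_mono (i : H →L[ℝ] E) (S : C0Semigroup E) (x : StrongDual ℝ E) {s t : ℝ}
    (hs : 0 ≤ s) (hst : s ≤ t) : x ((covOp i S s).op x) ≤ x ((covOp i S t).op x) := by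
  have := covOp_quadratic_add i S x hs (sub_nonneg.2 hst)
  rw [add_sub_cancel] at this
  rw [this]
  exact le_add_of_nonneg_right ((covOp i S _).nonneg _)

theorem semigroupInfty_map_add (hQ : HypQInfty i S) {s t : ℝ} (hs : 0 ≤ s) (ht : 0 ≤ t) :
    semigroupInfty hQ (s + t) = (semigroupInfty hQ s).comp (semigroupInfty hQ t) := by
  have hr := semigroupInfty_isRestriction hQ
  ext k
  refine (covOpInfty hQ).emb_injective ?_
  rw [hr _ (add_nonneg hs ht), ContinuousLinearMap.comp_apply, hr s hs, hr t ht,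
    S.map_add s t hs ht]
  rfl

/-- With `covOpInfty_comp_le_norm_semigroupInfty`, this identifies `‖S_∞(t)‖²` as an optimal
constant between forms. -/
theorem norm_semigroupInfty_le (hQ : HypQInfty i S) {t c : ℝ} (ht : 0 ≤ t) (hc : 0 ≤ c)
    (h : ∀ x : StrongDual ℝ E, (x.comp (S t)) ((covOpInfty hQ).op (x.comp (S t))) ≤
      c ^ 2 * x ((covOpInfty hQ).op x)) : ‖semigroupInfty hQ t‖ ≤ c := by
  refine norm_le_of_norm_adj_comp_le (covOpInfty hQ).emb_injective
    (semigroupInfty_isRestriction hQ t ht) hc fun x => ?_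
  refine le_of_sq_le_sq ?_ (by positivity)
  rw [mul_pow, PosSymmOp.norm_adj_emb_sq, PosSymmOp.norm_adj_emb_sq]
  exact h x

theorem covOpInfty_comp_le_norm_semigroupInfty (hQ : HypQInfty i S) {t : ℝ} (ht : 0 ≤ t)
    (x : StrongDual ℝ E) :
    (x.comp (S t)) ((covOpInfty hQ).op (x.comp (S t))) ≤
      ‖semigroupInfty hQ t‖ ^ 2 * x ((covOpInfty hQ).op x) := by
  rw [← PosSymmOp.norm_adj_emb_sq, ← PosSymmOp.norm_adj_emb_sq, ← mul_pow]
  gcongr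
  exact norm_adj_comp_le (semigroupInfty_isRestriction hQ t ht) x

theorem uniformlyExpStable_semigroupInfty (hQ : HypQInfty i S) {t : ℝ} (ht : 0 < t)
    (h : ‖semigroupInfty hQ t‖ < 1) : UniformlyExpStable (semigroupInfty hQ) :=
  uniformlyExpStable_of_norm_lt_one (fun _ _ => semigroupInfty_map_add hQ) (M := 1) ht
    (fun _ hs => norm_semigroupInfty_le hQ hs.1 zero_le_one fun x => by
      simpa using covOpInfty_comp_le hQ hs.1 x) h

/-- The comparison `Q_t ≤ Q_∞` is automatic, so only the reverse one has content. Conversely,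
equality of the ranges alone gives it, through the closed graph theorem. -/
theorem equalWithEquivNorms_covOp_iff (hQ : HypQInfty i S) {t : ℝ} (ht : 0 ≤ t) :
    EqualWithEquivNorms (covOp i S t).emb (covOpInfty hQ).emb ↔
      ∃ C : ℝ, 0 < C ∧ ∀ x : StrongDual ℝ E,
        x ((covOpInfty hQ).op x) ≤ C * x ((covOp i S t).op x) := by
  constructor
  · rintro ⟨h, -⟩
    obtain ⟨T, hT⟩ := exists_factor_of_range_subset (covOp i S t).emb_injective h.symm.subset
    refine ⟨‖T‖ ^ 2 + 1, by positivity, fun x => ?_⟩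
    have h1 := pow_le_pow_left₀ (norm_nonneg _) (norm_adj_le_of_factor hT x) 2
    rw [mul_pow, PosSymmOp.norm_adj_emb_sq, PosSymmOp.norm_adj_emb_sq] at h1
    linarith [(covOp i S t).nonneg x]
  · rintro ⟨C, hC, h⟩
    refine equalWithEquivNorms_of_norm_adj_le (C₁ := 1) (C₂ := Real.sqrt C)
      (covOp i S t).emb_injective (covOpInfty hQ).emb_injective (fun x => ?_) fun x => ?_
    · refine le_of_sq_le_sq ?_ (by positivity)
      rw [one_mul, PosSymmOp.norm_adj_emb_sq, PosSymmOp.norm_adj_emb_sq]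
      exact covOp_quadratic_le_covOpInfty hQ x ht
    · refine le_of_sq_le_sq ?_ (by positivity)
      rw [mul_pow, Real.sq_sqrt hC.le, PosSymmOp.norm_adj_emb_sq, PosSymmOp.norm_adj_emb_sq]
      exact h x

theorem UniformlyExpStable.exists_norm_le {K : Type*} [NormedAddCommGroup K] [NormedSpace ℝ K]
    {T : ℝ → (K →L[ℝ] K)} (h : UniformlyExpStable T) : ∃ t : ℝ, 0 < t ∧ ‖T t‖ ≤ 1 / 2 := by
  obtain ⟨M, ω, -, hω, hb⟩ := h
  have h1 : Tendsto (fun t : ℝ => M * Real.exp (-ω * t)) atTop (𝓝 (M * 0)) := by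
    refine (Real.tendsto_exp_atBot.comp ?_).const_mul M
    exact tendsto_id.const_mul_atTop_of_neg (neg_lt_zero.2 hω)
  rw [mul_zero] at h1
  obtain ⟨t, ht, ht0⟩ :=
    ((h1.eventually (ge_mem_nhds (by norm_num : (0 : ℝ) < 1 / 2))).and
      (eventually_gt_atTop 0)).exists
  exact ⟨t, ht0, (hb t ht0.le).trans ht⟩

/-- If `S_∞` is uniformly exponentially stable, then `Q_∞ ≤ C Q_t` for some `t > 0`. -/
theorem exists_equalWithEquivNorms (hQ : HypQInfty i S)
    (h : UniformlyExpStable (semigroupInfty hQ)) :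
    ∃ t : ℝ, 0 < t ∧ EqualWithEquivNorms (covOp i S t).emb (covOpInfty hQ).emb := by
  obtain ⟨t, ht, hn⟩ := h.exists_norm_le
  -- From `V_∞ ≤ V_t + V_∞ / 4` the constant 4/3 would do; 2 is ample.
  refine ⟨t, ht, (equalWithEquivNorms_covOp_iff hQ ht.le).2 ⟨2, by norm_num, fun x => ?_⟩⟩
  have h1 := covOpInfty_comp_le_norm_semigroupInfty hQ ht.le x
  have h2 := covOpInfty_quadratic_eq_add hQ x ht.le
  have h3 : ‖semigroupInfty hQ t‖ ^ 2 ≤ (1 / 2) ^ 2 := by gcongr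
  have h4 := mul_le_mul_of_nonneg_right h3 ((covOpInfty hQ).nonneg x)
  linarith [(covOpInfty hQ).nonneg x]

theorem covOp_comp_le_norm {S_H : C0Semigroup H} (hS : IsRestriction i S S_H)
    (x : StrongDual ℝ E) {t r : ℝ} (ht : 0 ≤ t) (hr : 0 ≤ r) :
    (x.comp (S t)) ((covOp i S r).op (x.comp (S t))) ≤
      ‖S_H t‖ ^ 2 * x ((covOp i S r).op x) := by
  rw [covOp_quadratic i S _ hr, covOp_quadratic i S _ hr, ← intervalIntegral.integral_const_mul]
  refine intervalIntegral.integral_mono_on hr (intervalIntegrable_norm_adj_sq i S _ le_rfl hr)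
    ((intervalIntegrable_norm_adj_sq i S _ le_rfl hr).const_mul _) fun s hs => ?_
  -- `S*(s)` and `S*(t)` commute, so `S*(t)` can be made to act last and be estimated by `S_H t`.
  rw [S.comp_comp x hs.1 ht, add_comm, ← S.comp_comp x ht hs.1, ← mul_pow]
  gcongr
  exact norm_adj_comp_le (hS t ht) _

end Covariance

/-! ### The implications involving `S_H` -/

section Equivalence

variable {E : Type*} [NormedAddCommGroup E] [NormedSpace ℝ E] [CompleteSpace E]
  {H : Type*} [NormedAddCommGroup H] [InnerProductSpace ℝ H] [CompleteSpace H]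
  {i : H →L[ℝ] E} {S : C0Semigroup E} {S_H : C0Semigroup H}

theorem uniformlyExpStable_semigroupInfty_of_restriction (hQ : HypQInfty i S)
    (hS : IsRestriction i S S_H) (h : UniformlyExpStable S_H) :
    UniformlyExpStable (semigroupInfty hQ) := by
  obtain ⟨t, ht, hn⟩ := h.exists_norm_le
  refine uniformlyExpStable_semigroupInfty hQ ht (lt_of_le_of_lt ?_ one_half_lt_one)
  refine norm_semigroupInfty_le hQ ht.le (by norm_num) fun x => ?_
  refine le_of_tendsto_of_tendsto (covOpInfty_tendsto hQ (x.comp (S t)) (x.comp (S t)))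
    ((covOpInfty_tendsto hQ x x).const_mul _) ?_
  filter_upwards [eventually_ge_atTop 0] with r hr
  refine (covOp_comp_le_norm hS x ht.le hr).trans ?_
  have := (covOp i S r).nonneg x
  gcongr

/-- `Q_{nt} ≤ C Q_t`. -/
theorem exists_covOp_nat_mul_le (hS : IsRestriction i S S_H) {t : ℝ} (ht : 0 ≤ t) (n : ℕ) :
    ∃ C : ℝ, 0 ≤ C ∧ ∀ x : StrongDual ℝ E,
      x ((covOp i S (n * t)).op x) ≤ C * x ((covOp i S t).op x) := by
  induction n with
  | zero =>
    refine ⟨0, le_rfl, fun x => ?_⟩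
    rw [Nat.cast_zero, zero_mul, covOp_quadratic i S x le_rfl]
    simp
  | succ n ih =>
    obtain ⟨C, hC, h⟩ := ih
    -- `V_{t+nt}(x) = V_t(x) + V_{nt}(S*(t) x)`, and the last term is at most `‖S_H t‖² V_{nt}(x)`.
    refine ⟨1 + ‖S_H t‖ ^ 2 * C, by positivity, fun x => ?_⟩
    have e : ((n + 1 : ℕ) : ℝ) * t = t + n * t := by push_cast; ring
    have hnt : 0 ≤ n * t := by positivity
    rw [e, covOp_quadratic_add i S x ht hnt]
    have h1 := covOp_comp_le_norm hS x ht hnt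
    have h2 := mul_le_mul_of_nonneg_left (h x) (sq_nonneg ‖S_H t‖)
    linarith

theorem equalWithEquivNorms_forall (hQ : HypQInfty i S) (hS : IsRestriction i S S_H)
    (h : ∃ t : ℝ, 0 < t ∧ EqualWithEquivNorms (covOp i S t).emb (covOpInfty hQ).emb)
    {t : ℝ} (ht : 0 < t) : EqualWithEquivNorms (covOp i S t).emb (covOpInfty hQ).emb := by
  obtain ⟨t₀, ht₀, h⟩ := h
  rw [equalWithEquivNorms_covOp_iff hQ ht₀.le] at h
  rw [equalWithEquivNorms_covOp_iff hQ ht.le]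
  obtain ⟨C, hC, h⟩ := h
  obtain ⟨n, hn⟩ := exists_nat_ge (t₀ / t)
  rw [div_le_iff₀ ht] at hn
  obtain ⟨C', hC', h'⟩ := exists_covOp_nat_mul_le hS ht.le n
  refine ⟨C * (C' + 1), by positivity, fun x => ?_⟩
  calc x ((covOpInfty hQ).op x) ≤ C * x ((covOp i S t₀).op x) := h x
    _ ≤ C * x ((covOp i S (n * t)).op x) := by
      gcongr
      exact covOp_quadratic_mono i S x ht₀.le hn
    _ ≤ C * ((C' + 1) * x ((covOp i S t).op x)) := by
      gcongr
      linarith [h' x, (covOp i S t).nonneg x]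
    _ = _ := by ring

theorem covOp_quadratic_le_norm_adj (hS : IsRestriction i S S_H) {t M : ℝ} (ht : 0 ≤ t)
    (hM : ∀ s ∈ Set.Icc 0 t, ‖S_H s‖ ≤ M) (x : StrongDual ℝ E) :
    x ((covOp i S t).op x) ≤ t * (M ^ 2 * ‖adj i x‖ ^ 2) := by
  rw [covOp_quadratic i S x ht]
  calc ∫ s in (0 : ℝ)..t, ‖adj i (x.comp (S s))‖ ^ 2
      ≤ ∫ _ in (0 : ℝ)..t, M ^ 2 * ‖adj i x‖ ^ 2 := by
        refine intervalIntegral.integral_mono_on ht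
          (intervalIntegrable_norm_adj_sq i S x le_rfl ht) intervalIntegrable_const fun s hs => ?_
        rw [← mul_pow]
        gcongr
        exact (norm_adj_comp_le (hS s hs.1) x).trans
          (mul_le_mul_of_nonneg_right (hM s hs) (norm_nonneg _))
    _ = _ := by rw [intervalIntegral.integral_const, sub_zero, smul_eq_mul]

theorem range_covOpInfty_subset (hi : Function.Injective i) (hQ : HypQInfty i S)
    (hS : IsRestriction i S S_H)
    (h : EqualWithEquivNorms (covOp i S 1).emb (covOpInfty hQ).emb) :
    Set.range (covOpInfty hQ).emb ⊆ Set.range i := by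
  obtain ⟨C, hC, h⟩ := (equalWithEquivNorms_covOp_iff hQ zero_le_one).1 h
  obtain ⟨M, hM0, hM⟩ := S_H.exists_bound 1
  obtain ⟨T, hT⟩ := exists_factor_of_norm_adj_le (j₁ := (covOpInfty hQ).emb) hi
    (C := Real.sqrt C * M) fun x => by
      refine le_of_sq_le_sq ?_ (by positivity)
      rw [PosSymmOp.norm_adj_emb_sq, mul_pow, mul_pow, Real.sq_sqrt hC.le]
      have := mul_le_mul_of_nonneg_left (covOp_quadratic_le_norm_adj hS zero_le_one hM x) hC.le
      linarith [h x]
  rintro _ ⟨k, rfl⟩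
  exact ⟨T k, hT k⟩

/-- Datko's estimate: an interval of times at which `S_H` is bounded by `M` forces decay. -/
theorem mul_norm_adj_comp_sq_le (hS : IsRestriction i S S_H) {a t M : ℝ} (ha : 0 ≤ a)
    (hat : a ≤ t) (hM : ∀ s ∈ Set.Icc 0 a, ‖S_H s‖ ≤ M) (x : StrongDual ℝ E) :
    a * ‖adj i (x.comp (S t))‖ ^ 2 ≤ M ^ 2 * x ((covOp i S t).op x) := by
  have ht : 0 ≤ t := ha.trans hat
  have hta : 0 ≤ t - a := sub_nonneg.2 hat
  calc a * ‖adj i (x.comp (S t))‖ ^ 2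
      -- For `s` in the window `[t - a, t]`, `S*(t) x = S*(t - s) S*(s) x` with `t - s ∈ [0, a]`,
      -- where `S_H` is bounded by `M`.
      = ∫ _ in (t - a)..t, ‖adj i (x.comp (S t))‖ ^ 2 := by
        rw [intervalIntegral.integral_const, smul_eq_mul]; ring
    _ ≤ ∫ s in (t - a)..t, M ^ 2 * ‖adj i (x.comp (S s))‖ ^ 2 := by
        refine intervalIntegral.integral_mono_on (by linarith) intervalIntegrable_const
          ((intervalIntegrable_norm_adj_sq i S x hta ht).const_mul _) fun s hs => ?_
        have hts : 0 ≤ t - s := sub_nonneg.2 hs.2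
        have e := S.comp_comp x hts (hta.trans hs.1)
        rw [add_sub_cancel] at e
        rw [← e, ← mul_pow]
        gcongr
        exact (norm_adj_comp_le (hS _ hts) _).trans (mul_le_mul_of_nonneg_right
          (hM _ ⟨hts, by linarith [hs.1]⟩) (norm_nonneg _))
    _ = M ^ 2 * ∫ s in (t - a)..t, ‖adj i (x.comp (S s))‖ ^ 2 :=
        intervalIntegral.integral_const_mul _ _
    _ ≤ M ^ 2 * x ((covOp i S t).op x) := by
        gcongr
        rw [covOp_quadratic i S x ht, ← intervalIntegral.integral_add_adjacent_intervals
          (intervalIntegrable_norm_adj_sq i S x le_rfl hta)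
          (intervalIntegrable_norm_adj_sq i S x hta ht)]
        exact le_add_of_nonneg_left
          (intervalIntegral.integral_nonneg hta fun s _ => sq_nonneg _)

/-- Datko's estimate is used twice: windows of length 1 bound `S_H` on the whole half-line, and then
the full window `[0, t]` gives `t ‖S_H t‖² ≤ N² ‖T‖²`. -/
theorem uniformlyExpStable_of_range_subset (hi : Function.Injective i) (hQ : HypQInfty i S)
    (hS : IsRestriction i S S_H)
    (h : Set.range (covOpInfty hQ).emb ⊆ Set.range i) : UniformlyExpStable S_H := by
  obtain ⟨T, hT⟩ := exists_factor_of_range_subset hi h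
  have hV : ∀ (t : ℝ), 0 ≤ t → ∀ x : StrongDual ℝ E,
      x ((covOp i S t).op x) ≤ ‖T‖ ^ 2 * ‖adj i x‖ ^ 2 := fun t ht x => by
    refine (covOp_quadratic_le_covOpInfty hQ x ht).trans ?_
    rw [← PosSymmOp.norm_adj_emb_sq, ← mul_pow]
    gcongr
    exact norm_adj_le_of_factor hT x
  obtain ⟨M, hM0, hM⟩ := S_H.exists_bound 1
  have hbd : ∀ t, 0 ≤ t → ‖S_H t‖ ≤ max M (M * ‖T‖) := by
    intro t ht
    rcases le_total t 1 with h1 | h1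
    · exact (hM t ⟨ht, h1⟩).trans (le_max_left _ _)
    · refine le_max_of_le_right (norm_le_of_norm_adj_comp_le hi (hS t ht) (by positivity)
        fun x => le_of_sq_le_sq ?_ (by positivity))
      have h2 := mul_norm_adj_comp_sq_le hS zero_le_one h1 hM x
      have h3 := mul_le_mul_of_nonneg_left (hV t ht x) (sq_nonneg M)
      linarith
  set N := max M (M * ‖T‖)
  have hN : 0 ≤ N := le_max_of_le_left hM0
  -- This time is chosen so that `N² ‖T‖² ≤ t / 4`, hence `‖S_H t‖ ≤ 1/2`.
  have ht : (0 : ℝ) < 4 * (N * ‖T‖) ^ 2 + 1 := by positivity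
  set t : ℝ := 4 * (N * ‖T‖) ^ 2 + 1 with htdef
  refine uniformlyExpStable_of_norm_lt_one S_H.map_add ht (fun s hs => hbd s hs.1)
    (lt_of_le_of_lt ?_ one_half_lt_one)
  refine norm_le_of_norm_adj_comp_le hi (hS t ht.le) (by norm_num)
    fun x => le_of_sq_le_sq ?_ (by positivity)
  have h2 := mul_norm_adj_comp_sq_le hS ht.le le_rfl (fun s hs => hbd s hs.1) x
  have h3 := mul_le_mul_of_nonneg_left (hV t ht.le x) (sq_nonneg N)
  refine le_of_mul_le_mul_left (h2.trans (h3.trans ?_)) ht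
  have h4 : N ^ 2 * ‖T‖ ^ 2 ≤ t * (1 / 2) ^ 2 := by rw [htdef]; linarith [mul_pow N ‖T‖ 2]
  have h5 := mul_le_mul_of_nonneg_right h4 (sq_nonneg ‖adj i x‖)
  linarith

/-! ### Density of `H_∞` in `H` -/

/-- For `g = i* x` the integrand is `⟨i* S*(s) x, k⟩`. Young's inequality with weight `ε` leaves
`ε⁻¹ V_r(x) ≤ ε⁻¹ V_∞(x) = ε⁻¹ ‖T* g‖²`, and both sides are continuous in `g`. When `T* g = 0` the
parameter `ε` is free to tend to 0. -/
theorem inner_integral_le (hi : Function.Injective i) (hQ : HypQInfty i S)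
    (hS : IsRestriction i S S_H) {T : RKHS (covOpInfty hQ) →L[ℝ] H}
    (hT : ∀ k, i (T k) = (covOpInfty hQ).emb k) {r ε : ℝ} (hr : 0 ≤ r) (hε : 0 < ε) (g k : H) :
    2 * inner ℝ g (∫ s in (0 : ℝ)..r, S_H s k) ≤
      r * (ε * ‖k‖ ^ 2) + ε⁻¹ * ‖ContinuousLinearMap.adjoint T g‖ ^ 2 := by
  refine (denseRange_adj hi).induction_on
    (p := fun g => 2 * inner ℝ g (∫ s in (0 : ℝ)..r, S_H s k) ≤
      r * (ε * ‖k‖ ^ 2) + ε⁻¹ * ‖ContinuousLinearMap.adjoint T g‖ ^ 2) g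
    (isClosed_le (by fun_prop) (by fun_prop)) fun x => ?_
  have hint : IntervalIntegrable (fun s => S_H s k) volume 0 r := by
    refine ContinuousOn.intervalIntegrable ((S_H.continuousOn k).mono ?_)
    rw [Set.uIcc_of_le hr]
    exact Set.Icc_subset_Ici_self
  have hinner : IntervalIntegrable (fun s => inner ℝ (adj i x) (S_H s k)) volume 0 r :=
    ⟨(innerSL ℝ (adj i x)).integrable_comp hint.1, (innerSL ℝ (adj i x)).integrable_comp hint.2⟩
  have hT' : ‖ContinuousLinearMap.adjoint T (adj i x)‖ ^ 2 = x ((covOpInfty hQ).op x) := by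
    rw [← PosSymmOp.norm_adj_emb_sq]
    have := adj_comp_eq_adjoint (A := ContinuousLinearMap.id ℝ E) hT x
    rw [ContinuousLinearMap.comp_id] at this
    rw [this]
  have hle := mul_le_mul_of_nonneg_left (covOp_quadratic_le_covOpInfty hQ x hr)
    (inv_pos.2 hε).le
  rw [covOp_quadratic i S x hr] at hle
  have hq := intervalIntegrable_norm_adj_sq i S x le_rfl hr
  rw [hT']
  calc 2 * inner ℝ (adj i x) (∫ s in (0 : ℝ)..r, S_H s k)
      = ∫ s in (0 : ℝ)..r, 2 * inner ℝ (adj i x) (S_H s k) := by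
        rw [intervalIntegral.integral_const_mul]
        congr 1
        exact ((innerSL ℝ (adj i x)).intervalIntegral_comp_comm hint).symm
    _ ≤ ∫ s in (0 : ℝ)..r, (ε * ‖k‖ ^ 2 + ε⁻¹ * ‖adj i (x.comp (S s))‖ ^ 2) := by
        refine intervalIntegral.integral_mono_on hr
          (hinner.const_mul 2)
          (intervalIntegrable_const.add (hq.const_mul _)) fun s hs => ?_
        have e : inner ℝ (adj i x) (S_H s k) = inner ℝ (adj i (x.comp (S s))) k := by
          rw [inner_adj, inner_adj, hS s hs.1]; rfl
        rw [e]
        have h1 := real_inner_le_norm (adj i (x.comp (S s))) k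
        have h2 := two_mul_le_add_sq (Real.sqrt ε * ‖k‖) ((Real.sqrt ε)⁻¹ * ‖adj i (x.comp (S s))‖)
        have h3 : Real.sqrt ε * (Real.sqrt ε)⁻¹ = 1 := mul_inv_cancel₀ (Real.sqrt_pos.2 hε).ne'
        rw [mul_pow, mul_pow, inv_pow, Real.sq_sqrt hε.le] at h2
        have h4 : 2 * (Real.sqrt ε * ‖k‖) * ((Real.sqrt ε)⁻¹ * ‖adj i (x.comp (S s))‖) =
            2 * (‖adj i (x.comp (S s))‖ * ‖k‖) := by
          linear_combination 2 * ‖k‖ * ‖adj i (x.comp (S s))‖ * h3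
        linarith
    _ = r * (ε * ‖k‖ ^ 2) + ε⁻¹ * ∫ s in (0 : ℝ)..r, ‖adj i (x.comp (S s))‖ ^ 2 := by
        rw [intervalIntegral.integral_add intervalIntegrable_const (hq.const_mul _),
          intervalIntegral.integral_const, intervalIntegral.integral_const_mul, sub_zero,
          smul_eq_mul]
    _ ≤ _ := by linarith

theorem dense_preimage_range_covOpInfty (hi : Function.Injective i) (hQ : HypQInfty i S)
    (hS : IsRestriction i S S_H)
    (h : Set.range (covOpInfty hQ).emb ⊆ Set.range i) :
    Dense {h : H | i h ∈ Set.range (covOpInfty hQ).emb} := by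
  obtain ⟨T, hT⟩ := exists_factor_of_range_subset hi h
  have hdense : (LinearMap.range T.toLinearMap).topologicalClosure = ⊤ := by
    rw [Submodule.topologicalClosure_eq_top_iff, Submodule.eq_bot_iff]
    intro g hg
    have hTg : ContinuousLinearMap.adjoint T g = 0 := by
      refine ext_inner_left ℝ fun k => ?_
      rw [ContinuousLinearMap.adjoint_inner_right, inner_zero_right]
      exact (Submodule.mem_orthogonal _ _).1 hg _ ⟨k, rfl⟩
    have hle : ∀ r : ℝ, 0 ≤ r → inner ℝ g (∫ s in (0 : ℝ)..r, S_H s g) ≤ 0 := by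
      intro r hr
      have h1 : Tendsto (fun ε : ℝ => r * (ε * ‖g‖ ^ 2)) (𝓝[>] 0) (𝓝 (r * (0 * ‖g‖ ^ 2))) :=
        ((tendsto_id.mono_left nhdsWithin_le_nhds).mul_const _).const_mul _
      rw [zero_mul, mul_zero] at h1
      have h2 : 2 * inner ℝ g (∫ s in (0 : ℝ)..r, S_H s g) ≤ 0 := by
        refine ge_of_tendsto h1 ?_
        filter_upwards [self_mem_nhdsWithin] with ε hε
        have := inner_integral_le hi hQ hS hT hr hε g g
        rw [hTg] at this
        simpa using this
      linarith
    have hc : ContinuousWithinAt (fun s => S_H s g) (Set.Ici 0) 0 :=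
      S_H.continuousOn g 0 Set.self_mem_Ici
    -- The right derivative at 0 of `r ↦ ∫₀ʳ S_H(s) g ds` is `g`; paired with `g`, it is a limit of
    -- nonpositive quotients, so `‖g‖² ≤ 0`.
    have hderiv : HasDerivWithinAt (fun r => ∫ s in (0 : ℝ)..r, S_H s g) (S_H 0 g)
        (Set.Ici 0) 0 := by
      refine intervalIntegral.integral_hasDerivWithinAt_right IntervalIntegrable.refl
        (t := Set.Ioi 0) ?_ (hc.mono Set.Ioi_subset_Ici_self)
      exact ((S_H.continuousOn g).mono
        Set.Ioi_subset_Ici_self).stronglyMeasurableAtFilter_nhdsWithin measurableSet_Ioi 0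
    have hslope := ((innerSL ℝ g).hasFDerivAt.comp_hasDerivWithinAt (0 : ℝ) hderiv)
    have hlim := hasDerivWithinAt_iff_tendsto_slope.1 hslope
    have hg0 : inner ℝ g g ≤ 0 := by
      have : (innerSL ℝ g) (S_H 0 g) ≤ 0 := by
        rw [Set.Ici_sdiff_left] at hlim
        refine le_of_tendsto hlim ?_
        filter_upwards [self_mem_nhdsWithin] with r hr
        have hr' : (0 : ℝ) < r := hr
        rw [slope_def_field]
        refine div_nonpos_of_nonpos_of_nonneg ?_ (by linarith)
        simpa using hle r hr'.le
      simpa [S_H.map_zero] using this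
    exact inner_self_eq_zero.1 (le_antisymm hg0 real_inner_self_nonneg)
  refine ((Submodule.dense_iff_topologicalClosure_eq_top).2 hdense).mono ?_
  rintro _ ⟨k, rfl⟩
  exact ⟨k, (hT k).symm⟩

end Equivalence

end OUGap

theorem mainTheorem7
    {E : Type*} [NormedAddCommGroup E] [NormedSpace ℝ E] [CompleteSpace E]
    {H : Type*} [NormedAddCommGroup H] [InnerProductSpace ℝ H] [CompleteSpace H]
    (i : H →L[ℝ] E) (hi : Function.Injective i)
    (S : OUGap.C0Semigroup E) (hQ : OUGap.HypQInfty i S)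
    (S_H : OUGap.C0Semigroup H) (hS_H : OUGap.IsRestriction i S S_H) :
    List.TFAE [
      OUGap.UniformlyExpStable S_H,
      OUGap.UniformlyExpStable (OUGap.semigroupInfty hQ),
      ∃ t : ℝ, 0 < t ∧
        OUGap.EqualWithEquivNorms (OUGap.covOp i S t).emb (OUGap.covOpInfty hQ).emb,
      ∀ t : ℝ, 0 < t →
        OUGap.EqualWithEquivNorms (OUGap.covOp i S t).emb (OUGap.covOpInfty hQ).emb,
      Set.range (OUGap.covOpInfty hQ).emb ⊆ Set.range i] ∧
    (Set.range (OUGap.covOpInfty hQ).emb ⊆ Set.range i →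
      Dense {h : H | i h ∈ Set.range (OUGap.covOpInfty hQ).emb}) := by
  refine ⟨?_, OUGap.dense_preimage_range_covOpInfty hi hQ hS_H⟩
  tfae_have 1 → 2 := OUGap.uniformlyExpStable_semigroupInfty_of_restriction hQ hS_H
  tfae_have 2 → 3 := OUGap.exists_equalWithEquivNorms hQ
  tfae_have 3 → 4 := fun h _ ht => OUGap.equalWithEquivNorms_forall hQ hS_H h ht
  tfae_have 4 → 5 := fun h => OUGap.range_covOpInfty_subset hi hQ hS_H (h 1 one_pos)
  tfae_have 5 → 1 := OUGap.uniformlyExpStable_of_range_subset hi hQ hS_H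
  tfae_finish
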